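/- Let $n\ge 2$, let $p,q\ge 1$ be real, let $D\subset\mathbb R^n$ be a domain, let $m$ be Lebesgue measure in $\mathbb R^n$ and $m_1$ Lebesgue measure in $\mathbb R$, and let $f:D\to\mathbb R^n$ be continuous. **Curves and modulus.** A curve is a continuous map $\gamma:\Delta\to\mathbb R^n$ of an interval $\Delta\subset\mathbb R$; its locus is $|\gamma|=\gamma(\Delta)$, and $\gamma$ is a curve in $A$ if $|\gamma|\subset A$. For a locally rectifiable $\gamma$ (every closed subcurve has finite length) fix $t_0\in\Delta$ and let $l_\gamma(t)$ be the length of $\gamma|_{[t_0,t]}$ if $t\ge t_0$ and minus the length of $\gamma|_{[t,t_0]}$ if $t<t_0$; put $\Delta_\gamma=l_\gamma(\Delta)$, let $\gamma_0:\Delta_\gamma\to\mathbb R^n$ be the natural parametrization, $\gamma=\gamma_0\circ l_\gamma$, and $\int_\gamma\rho\,|dx|=\int_{\Delta_\gamma}\rho(\gamma_0(s))\,ds$. For a family $\Gamma$ of curves, $\rho\in\operatorname{adm}\Gamma$ means that $\rho:\mathbb R^n\to[0,\infty]$ is Borel and $\int_\gamma\rho\,|dx|\ge 1$ for every locally rectifiable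 $\gamma\in\Gamma$, and $$M_p(\Gamma)=\inf_{\rho\in\operatorname{adm}\Gamma}\int_{\mathbb R^n}\rho^p\,dm\qquad(=\infty\text{ if }\operatorname{adm}\Gamma=\varnothing).$$ A property holds for $p$-a.e. curve in $A$ if the family of the curves in $A$ for which it fails has $p$-modulus zero. For a family $\Gamma$ of curves in $D$ put $f(\Gamma)=\{f\circ\gamma:\gamma\in\Gamma\}$. If $\gamma$ in $D$ and $\widetilde\gamma=f\circ\gamma$ are locally rectifiable, $L_{\gamma,f}:\Delta_\gamma\to\Delta_{\widetilde\gamma}$ is the unique function with $L_{\gamma,f}\circ l_\gamma=l_{\widetilde\gamma}$ (both length functions normalized at the same $t_0$). **Mappings.** A map has the $N$-property if it takes null sets to null sets, and the $N^{-1}$-property if preimages of null sets are null sets. Consider the conditions * $(R)$: $f$ is differentiable a.e. in $D$ and has the $N$- and $N^{-1}$-properties; * $(L^{(1)}_p)$: for $p$-a.e. curve $\gamma$ in $D$, $f\circ\gamma$ is locally rectifiable and $L_{\gamma,f}$ has the $N$-property; * $(L^{(2)}_q)$: for $q$-a.e. curve $\widetilde\gamma$ in $f(D)$, each curve $\gamma$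 in $D$ with $f\circ\gamma=\widetilde\gamma$ is locally rectifiable and $L_{\gamma,f}$ has the $N^{-1}$-property. (The $N$- and $N^{-1}$-properties of $L_{\gamma,f}$ are with respect to $m_1$.) The mapping $f$ has *finite length $(p,q)$-distortion* if $(R)$, $(L^{(1)}_p)$ and $(L^{(2)}_q)$ hold. At points of differentiability let $J(x,f)=\det f'(x)$, $\|f'(x)\|=\max_{h\ne0}|f'(x)h|/|h|$, $l(f'(x))=\min_{h\ne 0}|f'(x)h|/|h|$, and $$K_{I,q}(x,f)=\frac{|J(x,f)|}{l(f'(x))^q},\qquad K_{O,p}(x,f)=\frac{\|f'(x)\|^p}{|J(x,f)|}\qquad\text{if }J(x,f)\ne0,$$ while both are $1$ if $f'(x)=0$ and $\infty$ if $J(x,f)=0\ne f'(x)$. For $E\subset D$ put $$K_{I,p}(y,f^{-1},E)=\sum_{x\in E\cap f^{-1}(y)}K_{O,p}(x,f).$$ **Theorem.** If $f$ has finite length $(p,q)$-distortion, then 1. $\displaystyle M_q(f(\Gamma))\le\int_D K_{I,q}(x,f)\,\rho^q(x)\,dm(x)$ for every family $\Gamma$ of curves in $D$ and every $\rho\in\operatorname{adm}\Gamma$;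 2. $\displaystyle M_p(\Gamma)\le\int_{f(E)}K_{I,p}(y,f^{-1},E)\,\rho_*^p(y)\,dm(y)$ for every Lebesgue measurable set $E\subset D$, every family $\Gamma$ of curves in $E$ and every $\rho_*\in\operatorname{adm}f(\Gamma)$. Moreover, (1) holds already if $f$ satisfies $(R)$ and $(L^{(2)}_q)$, and (2) holds already if $f$ satisfies $(R)$ and $(L^{(1)}_p)$. -/

import Mathlib

open Set MeasureTheory
open scoped ENNReal

noncomputable section

namespace PQDistortion

/-- Euclidean space of dimension `n`, with the Euclidean norm and the Lebesgue measure `volume`. -/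
abbrev E (n : ℕ) : Type := EuclideanSpace ℝ (Fin n)

/-- A curve in `ℝⁿ`: a continuous map of an interval `dom` (open, closed or half-open, bounded or
not) into `ℝⁿ`. Values of `toFun` outside `dom` carry no meaning, and nothing below uses them. -/
structure Curve (n : ℕ) where
  dom : Set ℝ
  ordConnected : dom.OrdConnected
  nonempty : dom.Nonempty
  toFun : ℝ → E n
  continuousOn : ContinuousOn toFun dom

namespace Curve

variable {n : ℕ}

/-- The locus `|γ|`. -/
def locus (γ : Curve n) : Set (E n) := γ.toFun '' γ.dom

/-- The parameter `t₀` at which length functions are normalized; it depends on `dom` only. -/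
def base (γ : Curve n) : ℝ := γ.nonempty.some

/-- Every closed subcurve has finite length. -/
def LocallyRectifiable (γ : Curve n) : Prop :=
  LocallyBoundedVariationOn γ.toFun γ.dom

/-- The length function `l_γ`: the length of `γ` over `[t₀, t]` for `t ≥ t₀`, and minus the length
of `γ` over `[t, t₀]` for `t < t₀`. -/
def length (γ : Curve n) : ℝ → ℝ := variationOnFromTo γ.toFun γ.dom γ.base

/-- The length interval `Δ_γ`. -/
def lengthInterval (γ : Curve n) : Set ℝ := γ.length '' γ.dom

/-- The natural parametrization `γ₀` of `γ`, for which `γ₀ (l_γ t) = γ t`. -/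
def natural (γ : Curve n) : ℝ → E n := naturalParameterization γ.toFun γ.dom γ.base

/-- The integral `∫_γ ρ |dx|` over a locally rectifiable curve. -/
def lineIntegral (γ : Curve n) (ρ : E n → ℝ≥0∞) : ℝ≥0∞ :=
  ∫⁻ s in γ.lengthInterval, ρ (γ.natural s)

/-- The length function, with the same `t₀`, of the curve `g ∘ γ`. -/
def imageLength (γ : Curve n) (g : E n → E n) : ℝ → ℝ :=
  variationOnFromTo (g ∘ γ.toFun) γ.dom γ.base

/-- The function `L_{γ,g}` on the length interval of `γ`, for which
`L_{γ,g} (l_γ t) = l_{g ∘ γ} t`, see `lengthTransfer_length`. -/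
def lengthTransfer (γ : Curve n) (g : E n → E n) : ℝ → ℝ :=
  γ.imageLength g ∘ Function.invFunOn γ.length γ.dom

theorem base_mem (γ : Curve n) : γ.base ∈ γ.dom := γ.nonempty.some_mem

theorem lengthTransfer_length (γ : Curve n) (g : E n → E n) (hγ : γ.LocallyRectifiable)
    (hg : LocallyBoundedVariationOn (g ∘ γ.toFun) γ.dom) {t : ℝ} (ht : t ∈ γ.dom) :
    γ.lengthTransfer g (γ.length t) = γ.imageLength g t := by
  have hex : ∃ a ∈ γ.dom, γ.length a = γ.length t := ⟨t, ht, rfl⟩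
  set u := Function.invFunOn γ.length γ.dom (γ.length t) with hu
  have hum : u ∈ γ.dom := Function.invFunOn_mem hex
  have hue : γ.length u = γ.length t := Function.invFunOn_eq hex
  have h0 : variationOnFromTo γ.toFun γ.dom u t = 0 := by
    have := variationOnFromTo.add hγ γ.base_mem hum ht
    have h1 : variationOnFromTo γ.toFun γ.dom γ.base u
        = variationOnFromTo γ.toFun γ.dom γ.base t := hue
    linarith
  have h2 : variationOnFromTo (g ∘ γ.toFun) γ.dom u t = 0 := by
    rw [variationOnFromTo.eq_zero_iff hg hum ht]
    rw [variationOnFromTo.eq_zero_iff hγ hum ht] at h0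
    intro x hx y hy
    have := edist_eq_zero.mp (h0 hx hy)
    simp [this]
  have h3 := variationOnFromTo.add hg γ.base_mem hum ht
  change variationOnFromTo (g ∘ γ.toFun) γ.dom γ.base u
    = variationOnFromTo (g ∘ γ.toFun) γ.dom γ.base t
  linarith

/-- `α` is a (whole) lifting of `β` under `f : D → ℝⁿ`, that is, `α` is a curve in `D`
and `β = f ∘ α`. -/
def IsLifting (f : E n → E n) (D : Set (E n)) (α β : Curve n) : Prop :=
  α.locus ⊆ D ∧ β.dom = α.dom ∧ EqOn β.toFun (f ∘ α.toFun) α.dom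

end Curve

variable {n : ℕ}

/-- The family `f(Γ)` of the curves `f ∘ γ`, `γ ∈ Γ`, for a family `Γ` of curves in `D`. -/
def imageFamily (f : E n → E n) (D : Set (E n)) (Γ : Set (Curve n)) : Set (Curve n) :=
  {β | ∃ γ ∈ Γ, Curve.IsLifting f D γ β}

/-- `ρ ∈ adm Γ`. -/
def Admissible (Γ : Set (Curve n)) (ρ : E n → ℝ≥0∞) : Prop :=
  Measurable ρ ∧ ∀ γ ∈ Γ, γ.LocallyRectifiable → 1 ≤ γ.lineIntegral ρ

/-- The `p`-modulus `M_p(Γ)`; it is `∞` if no function is admissible. -/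
def modulus (p : ℝ) (Γ : Set (Curve n)) : ℝ≥0∞ :=
  ⨅ (ρ : E n → ℝ≥0∞) (_ : Admissible Γ ρ), ∫⁻ x, ρ x ^ p

/-- The property `P` holds for `p`-almost every curve in the set `A`. -/
def AlmostEveryCurve (p : ℝ) (A : Set (E n)) (P : Curve n → Prop) : Prop :=
  modulus p {γ : Curve n | γ.locus ⊆ A ∧ ¬ P γ} = 0

/-- Lusin's `N`-property of a map defined on `A`. -/
def PropertyN {X Y : Type*} [MeasureSpace X] [MeasureSpace Y] (g : X → Y) (A : Set X) : Prop :=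
  ∀ S ⊆ A, volume S = 0 → volume (g '' S) = 0

/-- The `N⁻¹`-property of a map defined on `A`. -/
def PropertyNInv {X Y : Type*} [MeasureSpace X] [MeasureSpace Y] (g : X → Y) (A : Set X) : Prop :=
  ∀ S : Set Y, volume S = 0 → volume (A ∩ g ⁻¹' S) = 0

/-- The property `L⁽¹⁾_p`. The function `L_{γ,f}` is meaningful for locally rectifiable `γ` only,
but the curves that are not locally rectifiable do not affect any modulus. -/
def PropertyL1 (p : ℝ) (f : E n → E n) (D : Set (E n)) : Prop :=
  AlmostEveryCurve p D fun γ =>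
    LocallyBoundedVariationOn (f ∘ γ.toFun) γ.dom ∧
      PropertyN (γ.lengthTransfer f) γ.lengthInterval

/-- The property `L⁽²⁾_q`. Again the curves that are not locally rectifiable play no role. -/
def PropertyL2 (q : ℝ) (f : E n → E n) (D : Set (E n)) : Prop :=
  AlmostEveryCurve q (f '' D) fun β =>
    ∀ γ : Curve n, Curve.IsLifting f D γ β →
      γ.LocallyRectifiable ∧ PropertyNInv (γ.lengthTransfer f) γ.lengthInterval

/-- `f` is differentiable almost everywhere in `D` and has the `N`- and `N⁻¹`-properties. -/
structure RegularMapping (f : E n → E n) (D : Set (E n)) : Prop where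
  differentiable_ae : ∀ᵐ x ∂(volume.restrict D), DifferentiableAt ℝ f x
  propertyN : PropertyN f D
  propertyNInv : PropertyNInv f D

/-- Mappings `f : D → ℝⁿ` with finite length `(p, q)`-distortion. -/
structure FiniteLengthDistortion (p q : ℝ) (f : E n → E n) (D : Set (E n)) : Prop
    extends RegularMapping f D where
  propertyL1 : PropertyL1 p f D
  propertyL2 : PropertyL2 q f D

/-- `l(A) = min_{h ≠ 0} |A h| / |h|`. -/
def minStretch (A : E n →L[ℝ] E n) : ℝ := ⨅ h : {h : E n // h ≠ 0}, ‖A h‖ / ‖(h : E n)‖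

open Classical in
/-- The inner dilatation `K_{I,q}(x, f)`. It is used at points of differentiability of `f`; the
value given elsewhere is irrelevant for mappings differentiable almost everywhere. -/
def innerDilatation (q : ℝ) (f : E n → E n) (x : E n) : ℝ≥0∞ :=
  if (fderiv ℝ f x).det ≠ 0 then
    ENNReal.ofReal (|(fderiv ℝ f x).det| / minStretch (fderiv ℝ f x) ^ q)
  else if fderiv ℝ f x = 0 then 1 else ∞

open Classical in
/-- The outer dilatation `K_{O,p}(x, f)`. It is used at points of differentiability of `f`; the
value given elsewhere is irrelevant for mappings differentiable almost everywhere that have the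
`N`-property. -/
def outerDilatation (p : ℝ) (f : E n → E n) (x : E n) : ℝ≥0∞ :=
  if (fderiv ℝ f x).det ≠ 0 then
    ENNReal.ofReal (‖fderiv ℝ f x‖ ^ p / |(fderiv ℝ f x).det|)
  else if fderiv ℝ f x = 0 then 1 else ∞

/-- `K_{I,p}(y, f⁻¹, A)`, the sum of `K_{O,p}(x, f)` over all `x ∈ A` with `f x = y`. -/
def inverseDilatation (p : ℝ) (f : E n → E n) (A : Set (E n)) (y : E n) : ℝ≥0∞ :=
  ∑' x : ↥(A ∩ f ⁻¹' {y}), outerDilatation p f x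

/-- The Poletskii type inequality
`M_q(f(Γ)) ≤ ∫_D K_{I,q}(x, f) ρ(x)^q dm(x)` for all `Γ` in `D` and `ρ ∈ adm Γ`. -/
def PoletskiiInequality (q : ℝ) (f : E n → E n) (D : Set (E n)) : Prop :=
  ∀ Γ : Set (Curve n), (∀ γ ∈ Γ, γ.locus ⊆ D) →
    ∀ ρ : E n → ℝ≥0∞, Admissible Γ ρ →
      modulus q (imageFamily f D Γ) ≤ ∫⁻ x in D, innerDilatation q f x * ρ x ^ q

/-- The inequality `M_p(Γ) ≤ ∫_{f(A)} K_{I,p}(y, f⁻¹, A) ρ_*(y)^p dm(y)` for all Lebesgue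
measurable `A ⊆ D`, all `Γ` in `A` and all `ρ_* ∈ adm f(Γ)`. -/
def InverseInequality (p : ℝ) (f : E n → E n) (D : Set (E n)) : Prop :=
  ∀ A : Set (E n), A ⊆ D → NullMeasurableSet A volume →
    ∀ Γ : Set (Curve n), (∀ γ ∈ Γ, γ.locus ⊆ A) →
      ∀ ρ : E n → ℝ≥0∞, Admissible (imageFamily f D Γ) ρ →
        modulus p Γ ≤ ∫⁻ y in f '' A, inverseDilatation p f A y * ρ y ^ p

end PQDistortion

end

/-!
# Modulus inequalities for mappings with finite length distortion

By Sard's theorem and the `N⁻¹`-property, almost every point of `D` belongs to the regular set,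
where `f` is differentiable with nonzero Jacobian. The regular set is a countable disjoint union of
Borel sets on which `f` is injective (`exists_partition_injOn_regularSet`), so the change of
variables formula is available there (`lintegral_fiberSup_le`,
`lintegral_regularSet_le_lintegral_tsum_fiber`). The remaining points form a null set whose image is
null by the `N`-property; a density may be made infinite on a null set without changing its
integral, so a curve that spends positive length in such a set never obstructs admissibility.

On a curve `γ` with image `f ∘ γ`, both parametrized by arc length, the derivative of `L = L_{γ,f}`
lies between the least stretching `l(f')` and the norm `‖f'‖` at almost every regular point
(`ae_minStretch_le_deriv_le_norm`), because arc length parametrizations have velocity of norm one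
almost everywhere. Changing variables along the monotone function `L` shows that, if `γ` spends no
length outside the regular set, a density `σ` with `σ (f x) ≥ ρ x / l(f'(x))` satisfies
`∫_{f ∘ γ} σ ≥ ∫_γ ρ`; if moreover `L` has the `N`-property, then `‖f'‖ ρ_* ∘ f` satisfies
`∫_γ ‖f'‖ ρ_* ∘ f ≥ ∫_{f ∘ γ} ρ_*`. The property `L⁽²⁾` guarantees that the lifts of almost every
curve that spends no length in the image of the exceptional points spend none in those points;
the property `L⁽¹⁾` supplies the `N`-property of `L`. The two inequalities follow by integrating
these densities over the regular set.
-/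

open Filter Topology

namespace PQDistortion

/-! ### Speed of curves parametrized by arc length -/

theorem dist_le_of_hasUnitSpeedOn {X : Type*} [PseudoMetricSpace X] {g : ℝ → X} {s : Set ℝ}
    (hg : HasUnitSpeedOn g s) {x y : ℝ} (hx : x ∈ s) (hy : y ∈ s) : dist (g x) (g y) ≤ |x - y| := by
  wlog hxy : x ≤ y generalizing x y
  · rw [dist_comm, abs_sub_comm]
    exact this hy hx (le_of_not_ge hxy)
  have h1 : edist (g x) (g y) ≤ eVariationOn g (s ∩ Icc x y) :=
    eVariationOn.edist_le g ⟨hx, le_rfl, hxy⟩ ⟨hy, hxy, le_rfl⟩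
  rw [hg hx hy, edist_dist, NNReal.coe_one, one_mul,
    ENNReal.ofReal_le_ofReal_iff (sub_nonneg.2 hxy)] at h1
  rwa [abs_sub_comm, abs_of_nonneg (sub_nonneg.2 hxy)]

theorem lipschitzOnWith_of_hasUnitSpeedOn {X : Type*} [PseudoMetricSpace X] {g : ℝ → X} {s : Set ℝ}
    (hg : HasUnitSpeedOn g s) : LipschitzOnWith 1 g s :=
  LipschitzOnWith.of_dist_le_mul fun x hx y hy => by
    simpa [Real.dist_eq] using dist_le_of_hasUnitSpeedOn hg hx hy

/-- A chord is at most the integral of the speed, by the fundamental theorem of calculus for the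
component of `G` in the direction of the chord. -/
theorem dist_le_integral_norm_deriv {V : Type*} [NormedAddCommGroup V] [InnerProductSpace ℝ V]
    [FiniteDimensional ℝ V] {G : ℝ → V} {C : NNReal} (hG : LipschitzWith C G) {x y : ℝ}
    (hxy : x ≤ y) : dist (G x) (G y) ≤ ∫ t in x..y, ‖deriv G t‖ := by
  set e := G y - G x with he
  let F : ℝ → ℝ := fun t => inner ℝ e (G t)
  have hF : LipschitzWith (‖e‖₊ * C) F := by
    refine LipschitzWith.of_dist_le_mul fun a b => ?_
    have h1 : F a - F b = inner ℝ e (G a - G b) := by simp only [F, inner_sub_right]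
    rw [Real.dist_eq, h1]
    refine (abs_real_inner_le_norm e (G a - G b)).trans ?_
    rw [← dist_eq_norm (G a)]
    have := hG.dist_le_mul a b
    push_cast
    rw [mul_assoc]
    exact mul_le_mul_of_nonneg_left this (norm_nonneg e)
  have hac := (hF.lipschitzOnWith (s := uIcc x y)).absolutelyContinuousOnInterval
  have hftc := hac.integral_deriv_eq_sub
  have hFe : F y - F x = ‖e‖ * ‖e‖ := by
    simp only [F, ← inner_sub_right, ← he, real_inner_self_eq_norm_mul_norm]
  have hint : IntervalIntegrable (fun t => ‖deriv G t‖) volume x y := by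
    rw [intervalIntegrable_iff]
    refine Measure.integrableOn_of_bounded (M := C) measure_Ioc_lt_top.ne ?_ ?_
    · exact (stronglyMeasurable_deriv G).norm.aestronglyMeasurable
    · exact ae_of_all _ fun t => by simpa using norm_deriv_le_of_lipschitz hG
  have hle : ∫ t in x..y, deriv F t ≤ ∫ t in x..y, ‖e‖ * ‖deriv G t‖ := by
    refine intervalIntegral.integral_mono_ae hxy hac.intervalIntegrable_deriv
      (hint.const_mul _) ?_
    filter_upwards [hG.ae_differentiableAt_real] with t ht
    have : HasDerivAt F (inner ℝ e (deriv G t)) t := by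
      simpa using (hasDerivAt_const t e).inner ℝ ht.hasDerivAt
    rw [this.deriv]
    exact real_inner_le_norm _ _
  rw [hftc, hFe, intervalIntegral.integral_const_mul] at hle
  rw [dist_comm, dist_eq_norm]
  rcases (norm_nonneg e).eq_or_lt with h0 | h0
  · rw [← he, ← h0]
    exact intervalIntegral.integral_nonneg hxy fun _ _ => norm_nonneg _
  · exact le_of_mul_le_mul_left hle h0

/-- A curve parametrized by arc length has velocity of norm one almost everywhere: otherwise the
integral of the speed, which bounds the length from above, would be too small. -/
theorem ae_hasDerivAt_of_hasUnitSpeedOn {V : Type*} [NormedAddCommGroup V] [InnerProductSpace ℝ V]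
    [FiniteDimensional ℝ V] {g : ℝ → V} {s : Set ℝ} (hs : s.OrdConnected)
    (hg : HasUnitSpeedOn g s) :
    ∀ᵐ x, x ∈ s → s ∈ 𝓝 x ∧ ∃ v, HasDerivAt g v x ∧ ‖v‖ = 1 := by
  refine ae_of_mem_of_ae_of_mem_inter_Ioo fun a b ha hb hab => ?_
  have hI : Icc a b ⊆ s := hs.out ha hb
  -- `G` extends `g` from `[a, b]` to a Lipschitz function on the line.
  let G : ℝ → V := fun t => g (projIcc a b hab.le t)
  have hGg : EqOn G g (Icc a b) := fun t ht => by simp [G, projIcc_of_mem hab.le ht]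
  have hG : LipschitzWith 1 G := by
    refine LipschitzWith.of_dist_le_mul fun x y => ?_
    have h1 := dist_le_of_hasUnitSpeedOn hg (hI (projIcc a b hab.le x).2)
      (hI (projIcc a b hab.le y).2)
    have h2 := (LipschitzWith.projIcc hab.le).dist_le_mul x y
    rw [Subtype.dist_eq, Real.dist_eq] at h2
    exact h1.trans h2
  have hle1 : ∀ t, ‖deriv G t‖ ≤ 1 := fun t => by simpa using norm_deriv_le_of_lipschitz hG
  have hii : ∀ x y, IntervalIntegrable (fun t => ‖deriv G t‖) volume x y := fun x y => by
    rw [intervalIntegrable_iff]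
    refine Measure.integrableOn_of_bounded (M := 1) measure_Ioc_lt_top.ne ?_ ?_
    · exact (stronglyMeasurable_deriv G).norm.aestronglyMeasurable
    · exact ae_of_all _ fun t => by simpa using hle1 t
  let v : ℝ → ℝ := fun t => ∫ r in a..t, ‖deriv G r‖
  have hsub : ∀ x y, v y - v x = ∫ r in x..y, ‖deriv G r‖ := fun x y =>
    intervalIntegral.integral_interval_sub_left (hii _ _) (hii _ _)
  have hv : Monotone v := fun x y hxy => by
    rw [← sub_nonneg, hsub]
    exact intervalIntegral.integral_nonneg hxy fun _ _ => norm_nonneg _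
  have hvar : eVariationOn g (Icc a b) ≤ eVariationOn v (Icc a b) := by
    refine iSup_le fun p => ?_
    refine le_trans (Finset.sum_le_sum fun i _ => ?_)
      (eVariationOn.sum_le (f := v) p.2.2.1 p.2.2.2)
    have h12 : (p.2 : ℕ → ℝ) i ≤ (p.2 : ℕ → ℝ) (i + 1) := p.2.2.1 i.le_succ
    rw [edist_comm, edist_comm (v _), edist_dist, edist_dist,
      ← hGg (p.2.2.2 i), ← hGg (p.2.2.2 (i + 1))]
    refine ENNReal.ofReal_le_ofReal ((dist_le_integral_norm_deriv hG h12).trans ?_)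
    rw [← hsub, dist_comm, Real.dist_eq]
    exact le_abs_self _
  have hba : b - a ≤ ∫ r in a..b, ‖deriv G r‖ := by
    have h1 := hg ha hb
    rw [inter_eq_self_of_subset_right hI, NNReal.coe_one, one_mul] at h1
    have h2 := (hv.monotoneOn (Icc a b)).eVariationOn_eq (left_mem_Icc.2 hab.le)
      (right_mem_Icc.2 hab.le)
    rw [inter_self, hsub] at h2
    rw [h1] at hvar
    exact (ENNReal.ofReal_le_ofReal_iff
      (intervalIntegral.integral_nonneg hab.le fun _ _ => norm_nonneg _)).1 (hvar.trans_eq h2)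
  have hzero : ∫ r in a..b, (1 - ‖deriv G r‖) = 0 := by
    refine le_antisymm ?_ (intervalIntegral.integral_nonneg hab.le fun t _ =>
      sub_nonneg.2 (hle1 t))
    rw [intervalIntegral.integral_sub intervalIntegrable_const (hii _ _)]
    simpa using hba
  rw [intervalIntegral.integral_eq_zero_iff_of_le_of_nonneg_ae hab.le
    (ae_of_all _ fun t => sub_nonneg.2 (hle1 t))
    (intervalIntegrable_const.sub (hii _ _)), EventuallyEq,
    ae_restrict_iff' measurableSet_Ioc] at hzero
  filter_upwards [hzero, hG.ae_differentiableAt_real] with x hx hdx hxs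
  have hn : Icc a b ∈ 𝓝 x := Icc_mem_nhds hxs.2.1 hxs.2.2
  refine ⟨mem_of_superset hn hI, deriv G x, ?_, ?_⟩
  · refine hdx.hasDerivAt.congr_of_eventuallyEq ?_
    filter_upwards [hn] with t ht using (hGg ht).symm
  · have := hx ⟨hxs.2.1, hxs.2.2.le⟩
    simp only [Pi.zero_apply] at this
    linarith

theorem norm_le_of_hasDerivAt_of_dist_le {V : Type*} [NormedAddCommGroup V] [NormedSpace ℝ V]
    {u : ℝ → V} {L : ℝ → ℝ} {v : V} {l x : ℝ} (hu : HasDerivAt u v x) (hL : HasDerivAt L l x)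
    (h : ∀ᶠ y in 𝓝 x, dist (u y) (u x) ≤ |L y - L x|) : ‖v‖ ≤ |l| := by
  rw [hasDerivAt_iff_tendsto_slope] at hu hL
  refine le_of_tendsto_of_tendsto hu.norm hL.abs ?_
  filter_upwards [nhdsWithin_le_nhds h] with y hy
  rw [slope_def_module, slope_def_module, norm_smul, smul_eq_mul, abs_mul, Real.norm_eq_abs,
    ← dist_eq_norm]
  exact mul_le_mul_of_nonneg_left hy (abs_nonneg _)

/-! ### Stretching of arc length -/

variable {n : ℕ}

theorem minStretch_mul_norm_le (A : E n →L[ℝ] E n) (v : E n) : minStretch A * ‖v‖ ≤ ‖A v‖ := by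
  rcases eq_or_ne v 0 with rfl | hv
  · simp
  · rw [← le_div_iff₀ (norm_pos_iff.2 hv)]
    exact ciInf_le (f := fun h : {h : E n // h ≠ 0} => ‖A h‖ / ‖(h : E n)‖)
      ⟨0, by rintro _ ⟨h, rfl⟩; positivity⟩ ⟨v, hv⟩

theorem minStretch_pos (hn : 0 < n) {A : E n →L[ℝ] E n} (hA : A.det ≠ 0) : 0 < minStretch A := by
  have : NeZero n := ⟨hn.ne'⟩
  obtain ⟨w, hw⟩ := exists_ne (0 : E n)
  have : Nonempty {h : E n // h ≠ 0} := ⟨w, hw⟩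
  have hker : LinearMap.ker (A : E n →ₗ[ℝ] E n) = ⊥ :=
    LinearMap.ker_eq_bot.2 (LinearMap.equivOfDetNeZero (A : E n →ₗ[ℝ] E n) hA).injective
  obtain ⟨K, hK, hKA⟩ := LinearMap.exists_antilipschitzWith (A : E n →ₗ[ℝ] E n) hker
  refine lt_of_lt_of_le (inv_pos.2 (NNReal.coe_pos.2 hK)) (le_ciInf fun h => ?_)
  have h1 := hKA.le_mul_dist h.1 0
  simp only [map_zero, dist_zero_right, ContinuousLinearMap.coe_coe] at h1
  rw [le_div_iff₀ (norm_pos_iff.2 h.2), inv_mul_le_iff₀ (NNReal.coe_pos.2 hK)]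
  exact h1

/-- The least stretching is Lipschitz with constant one in the operator norm. -/
theorem continuous_minStretch : Continuous (minStretch : (E n →L[ℝ] E n) → ℝ) := by
  rcases isEmpty_or_nonempty {h : E n // h ≠ 0} with hE | hE
  · have : (minStretch : (E n →L[ℝ] E n) → ℝ) = fun _ => 0 :=
      funext fun _ => Real.iInf_of_isEmpty _
    rw [this]
    exact continuous_const
  have key : ∀ A B : E n →L[ℝ] E n, minStretch A ≤ minStretch B + dist A B := fun A B => by
    rw [← sub_le_iff_le_add]
    refine le_ciInf fun h => ?_
    have hh := norm_pos_iff.2 h.2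
    rw [le_div_iff₀ hh, sub_mul]
    have h1 := minStretch_mul_norm_le A h
    have h2 : ‖A h‖ ≤ ‖B h‖ + ‖A - B‖ * ‖(h : E n)‖ := by
      have h3 := (A - B).le_opNorm h
      have h4 := norm_add_le (B h) ((A - B) h)
      simp only [sub_apply, add_sub_cancel] at h3 h4
      linarith
    rw [dist_eq_norm]
    linarith
  exact (LipschitzWith.of_le_add key).continuous

theorem measurableSet_inter_preimage_of_continuousOn {X Y : Type*} [TopologicalSpace X]
    [MeasurableSpace X] [BorelSpace X] [TopologicalSpace Y] [MeasurableSpace Y] [BorelSpace Y]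
    {φ : X → Y} {S : Set X} {T : Set Y} (hS : MeasurableSet S) (hφ : ContinuousOn φ S)
    (hT : MeasurableSet T) : MeasurableSet (S ∩ φ ⁻¹' T) := by
  rw [← Subtype.image_preimage_coe]
  exact hS.subtype_image (hφ.domRestrict.measurable hT)

/-- Let `g` and `h` be arc length parametrizations of a curve and of its image under `f`, and let
`L` relate the two arc lengths. Then `L'` lies between the least and the greatest stretching of
`f'`. The chain rule applied to `f ∘ g = h ∘ L` gives this where `h` has unit velocity at `L t`;
the remaining `t` are mapped by `L` into a null set, so that `L' = 0` at almost all of them. -/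
theorem ae_minStretch_le_deriv_le_norm {Δ Δ' : Set ℝ} {g h : ℝ → E n} {L : ℝ → ℝ} {f : E n → E n}
    (hΔ : Δ.OrdConnected) (hΔ' : Δ'.OrdConnected) (hg : HasUnitSpeedOn g Δ)
    (hh : HasUnitSpeedOn h Δ') (hL : MonotoneOn L Δ) (hmaps : MapsTo L Δ Δ')
    (hcomp : EqOn (h ∘ L) (f ∘ g) Δ) :
    ∀ᵐ t, t ∈ Δ → DifferentiableAt ℝ L t ∧ (DifferentiableAt ℝ f (g t) →
      minStretch (fderiv ℝ f (g t)) ≤ deriv L t ∧ deriv L t ≤ ‖fderiv ℝ f (g t)‖) := by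
  have hbad := ae_hasDerivAt_of_hasUnitSpeedOn hΔ' hh
  obtain ⟨T, hTsub, hTm, hT0⟩ := exists_measurable_superset_of_null hbad
  -- Since `L` maps `P` into the null set `T`, the change of variables formula gives `L' = 0` almost
  -- everywhere on `P`.
  let P : Set ℝ := (Δ ∩ {t | DifferentiableAt ℝ L t}) ∩ L ⁻¹' T
  have hΔD : MeasurableSet (Δ ∩ {t | DifferentiableAt ℝ L t}) :=
    hΔ.measurableSet.inter (measurableSet_of_differentiableAt ℝ L)
  have hLd : ∀ t ∈ Δ ∩ {t | DifferentiableAt ℝ L t},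
      HasDerivWithinAt L (deriv L t) (Δ ∩ {t | DifferentiableAt ℝ L t}) t :=
    fun t ht => ht.2.hasDerivAt.hasDerivWithinAt
  have hP : MeasurableSet P := by
    have hc : ContinuousOn L (Δ ∩ {t | DifferentiableAt ℝ L t}) :=
      fun t ht => ht.2.continuousAt.continuousWithinAt
    exact measurableSet_inter_preimage_of_continuousOn hΔD hc hTm
  have hP0 : ∫⁻ t in P, ENNReal.ofReal (deriv L t) = 0 := by
    rw [lintegral_deriv_eq_volume_image_of_monotoneOn hP
      (fun t ht => (hLd t ht.1).mono inter_subset_left) (hL.mono fun t ht => ht.1.1)]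
    exact measure_mono_null (by rintro _ ⟨t, ht, rfl⟩; exact ht.2) hT0
  rw [lintegral_eq_zero_iff (measurable_deriv L).ennreal_ofReal, EventuallyEq,
    ae_restrict_iff' hP] at hP0
  filter_upwards [hP0, ae_hasDerivAt_of_hasUnitSpeedOn hΔ hg, hL.ae_differentiableWithinAt_of_mem]
    with t ht1 ht2 ht3 htΔ
  obtain ⟨hnhds, v, hv, hv1⟩ := ht2 htΔ
  have hLt : DifferentiableAt ℝ L t := (ht3 htΔ).differentiableAt hnhds
  refine ⟨hLt, fun hf => ?_⟩
  have hu : HasDerivAt (f ∘ g) (fderiv ℝ f (g t) v) t := hf.hasFDerivAt.comp_hasDerivAt t hv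
  have hL0 : 0 ≤ deriv L t := by
    rw [← hLt.derivWithin (uniqueDiffWithinAt_of_mem_nhds hnhds)]
    exact hL.derivWithin_nonneg
  have hlow : ‖fderiv ℝ f (g t) v‖ ≤ deriv L t := by
    rw [← abs_of_nonneg hL0]
    refine norm_le_of_hasDerivAt_of_dist_le hu hLt.hasDerivAt ?_
    filter_upwards [hnhds] with y hy
    rw [← hcomp hy, ← hcomp htΔ]
    exact dist_le_of_hasUnitSpeedOn hh (hmaps hy) (hmaps htΔ)
  constructor
  · refine le_trans ?_ hlow
    simpa [hv1] using minStretch_mul_norm_le (fderiv ℝ f (g t)) v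
  · by_cases htT : L t ∈ T
    · have := ht1 ⟨⟨htΔ, hLt⟩, htT⟩
      simp only [Pi.zero_apply, ENNReal.ofReal_eq_zero] at this
      exact this.trans (norm_nonneg _)
    · have hgood : ¬ ¬ (L t ∈ Δ' → Δ' ∈ 𝓝 (L t) ∧ ∃ v, HasDerivAt h v (L t) ∧ ‖v‖ = 1) :=
        fun hc => htT (hTsub hc)
      obtain ⟨-, w, hw, hw1⟩ := not_not.1 hgood (hmaps htΔ)
      have hcl : HasDerivAt (h ∘ L) (deriv L t • w) t := hw.scomp t hLt.hasDerivAt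
      have heq : h ∘ L =ᶠ[𝓝 t] f ∘ g := by filter_upwards [hnhds] with y hy using hcomp hy
      have huniq := (hcl.congr_of_eventuallyEq heq.symm).unique hu
      calc deriv L t = ‖deriv L t • w‖ := by rw [norm_smul, hw1, mul_one, Real.norm_of_nonneg hL0]
        _ = ‖fderiv ℝ f (g t) v‖ := by rw [huniq]
        _ ≤ ‖fderiv ℝ f (g t)‖ := by simpa [hv1] using (fderiv ℝ f (g t)).le_opNorm v

/-! ### Curves and their images -/

namespace Curve

variable {γ β : Curve n} {f : E n → E n} {D : Set (E n)}

theorem natural_length (hγ : γ.LocallyRectifiable) {t : ℝ} (ht : t ∈ γ.dom) :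
    γ.natural (γ.length t) = γ.toFun t :=
  edist_eq_zero.1 (edist_naturalParameterization_eq_zero hγ γ.base_mem ht)

theorem natural_mem_locus (hγ : γ.LocallyRectifiable) {s : ℝ} (hs : s ∈ γ.lengthInterval) :
    γ.natural s ∈ γ.locus := by
  obtain ⟨t, ht, rfl⟩ := hs
  rw [natural_length hγ ht]
  exact mem_image_of_mem _ ht

theorem hasUnitSpeedOn_natural (hγ : γ.LocallyRectifiable) :
    HasUnitSpeedOn γ.natural γ.lengthInterval :=
  has_unit_speed_naturalParameterization γ.toFun hγ γ.base_mem

theorem monotoneOn_length (hγ : γ.LocallyRectifiable) : MonotoneOn γ.length γ.dom :=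
  variationOnFromTo.monotoneOn hγ γ.base_mem

/-- The length function has no jumps since `γ` has none. -/
theorem continuousOn_length (hγ : γ.LocallyRectifiable) : ContinuousOn γ.length γ.dom := by
  intro b hb
  have hc := γ.continuousOn b hb
  have hl := variationOnFromTo.tendsto_left γ.base_mem hb hγ
    (hc.mono_left (nhdsWithin_mono b inter_subset_left))
  have hr := variationOnFromTo.tendsto_right γ.base_mem hb hγ
    (hc.mono_left (nhdsWithin_mono b inter_subset_left))
  rw [dist_self, sub_zero] at hl
  rw [dist_self, add_zero] at hr
  have h0 : Tendsto γ.length (𝓝[γ.dom ∩ {b}] b) (𝓝 (γ.length b)) :=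
    (tendsto_pure_nhds γ.length b).mono_left
      ((nhdsWithin_mono b inter_subset_right).trans (nhdsWithin_singleton b).le)
  have hdom : γ.dom = (γ.dom ∩ Iio b ∪ γ.dom ∩ Ioi b) ∪ γ.dom ∩ {b} := by
    ext x
    simp only [mem_union, mem_inter_iff, mem_Iio, mem_Ioi, mem_singleton_iff]
    have := lt_trichotomy x b
    tauto
  rw [ContinuousWithinAt, hdom, nhdsWithin_union, nhdsWithin_union]
  exact (hl.sup hr).sup h0

theorem ordConnected_lengthInterval (hγ : γ.LocallyRectifiable) : γ.lengthInterval.OrdConnected :=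
  ((γ.ordConnected.isPreconnected).image _ (continuousOn_length hγ)).ordConnected

theorem measurableSet_lengthInterval (hγ : γ.LocallyRectifiable) :
    MeasurableSet γ.lengthInterval :=
  (ordConnected_lengthInterval hγ).measurableSet

theorem aemeasurable_comp_natural (hγ : γ.LocallyRectifiable) {ρ : E n → ℝ≥0∞}
    (hρ : Measurable ρ) :
    AEMeasurable (fun s => ρ (γ.natural s)) (volume.restrict γ.lengthInterval) :=
  hρ.comp_aemeasurable ((lipschitzOnWith_of_hasUnitSpeedOn
    (hasUnitSpeedOn_natural hγ)).continuousOn.aemeasurable (measurableSet_lengthInterval hγ))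

/-- A curve along which a density has a finite integral spends no length in a set where the density
is infinite. -/
theorem ae_natural_notMem_of_lineIntegral_ne_top (hγ : γ.LocallyRectifiable) {ρ : E n → ℝ≥0∞}
    (hρ : Measurable ρ) {N : Set (E n)} (hN : ∀ x ∈ N, ρ x = ∞) (h : γ.lineIntegral ρ ≠ ∞) :
    ∀ᵐ s ∂volume.restrict γ.lengthInterval, γ.natural s ∉ N := by
  filter_upwards [ae_lt_top' (aemeasurable_comp_natural hγ hρ) h] with s hs hsN
  exact hs.ne (hN _ hsN)

namespace IsLifting

theorem locallyBoundedVariationOn (h : IsLifting f D γ β) (hβ : β.LocallyRectifiable) :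
    LocallyBoundedVariationOn (f ∘ γ.toFun) γ.dom := by
  obtain ⟨-, hdom, heq⟩ := h
  intro a b ha hb
  have := hβ a b (hdom ▸ ha) (hdom ▸ hb)
  rwa [hdom, BoundedVariationOn, eVariationOn.congr (heq.mono inter_subset_left)] at this

theorem locallyRectifiable (h : IsLifting f D γ β)
    (hγ : LocallyBoundedVariationOn (f ∘ γ.toFun) γ.dom) : β.LocallyRectifiable := by
  obtain ⟨-, hdom, heq⟩ := h
  intro a b ha hb
  have := hγ a b (hdom ▸ ha) (hdom ▸ hb)
  rwa [hdom, BoundedVariationOn, eVariationOn.congr (heq.mono inter_subset_left)]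

theorem base_eq (h : IsLifting f D γ β) : β.base = γ.base := by
  obtain ⟨-, hdom, -⟩ := h
  obtain ⟨d, o, ne, φ, c⟩ := β
  obtain rfl : d = γ.dom := hdom
  rfl

theorem length_eq (h : IsLifting f D γ β) (t : ℝ) : β.length t = γ.imageLength f t := by
  have hb := h.base_eq
  obtain ⟨-, hdom, heq⟩ := h
  simp only [length, imageLength, variationOnFromTo, hb, hdom,
    eVariationOn.congr (heq.mono inter_subset_left)]

theorem lengthTransfer_length (h : IsLifting f D γ β) (hγ : γ.LocallyRectifiable)
    (hβ : β.LocallyRectifiable) {t : ℝ} (ht : t ∈ γ.dom) :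
    γ.lengthTransfer f (γ.length t) = β.length t := by
  rw [Curve.lengthTransfer_length γ f hγ (h.locallyBoundedVariationOn hβ) ht, h.length_eq]

theorem lengthTransfer_image (h : IsLifting f D γ β) (hγ : γ.LocallyRectifiable)
    (hβ : β.LocallyRectifiable) : γ.lengthTransfer f '' γ.lengthInterval = β.lengthInterval := by
  rw [lengthInterval, image_image, lengthInterval, h.2.1]
  exact image_congr fun t ht => h.lengthTransfer_length hγ hβ ht

theorem monotoneOn_lengthTransfer (h : IsLifting f D γ β) (hγ : γ.LocallyRectifiable)
    (hβ : β.LocallyRectifiable) : MonotoneOn (γ.lengthTransfer f) γ.lengthInterval := by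
  rintro _ ⟨a, ha, rfl⟩ _ ⟨b, hb, rfl⟩ hab
  rw [h.lengthTransfer_length hγ hβ ha, h.lengthTransfer_length hγ hβ hb]
  have hm : MonotoneOn β.length γ.dom := h.2.1 ▸ monotoneOn_length hβ
  rcases le_total a b with hle | hle
  · exact hm ha hb hle
  · have heq : γ.length a = γ.length b := le_antisymm hab (monotoneOn_length hγ hb ha hle)
    rw [← h.lengthTransfer_length hγ hβ ha, ← h.lengthTransfer_length hγ hβ hb, heq]

theorem natural_lengthTransfer (h : IsLifting f D γ β) (hγ : γ.LocallyRectifiable)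
    (hβ : β.LocallyRectifiable) :
    EqOn (β.natural ∘ γ.lengthTransfer f) (f ∘ γ.natural) γ.lengthInterval := by
  rintro _ ⟨t, ht, rfl⟩
  have ht' : t ∈ β.dom := h.2.1 ▸ ht
  simp only [Function.comp_apply]
  rw [h.lengthTransfer_length hγ hβ ht, natural_length hβ ht', natural_length hγ ht, h.2.2 ht]
  rfl

theorem ae_minStretch_le_deriv_le_norm (h : IsLifting f D γ β) (hγ : γ.LocallyRectifiable)
    (hβ : β.LocallyRectifiable) :
    ∀ᵐ s ∂volume.restrict γ.lengthInterval, DifferentiableAt ℝ (γ.lengthTransfer f) s ∧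
      (DifferentiableAt ℝ f (γ.natural s) →
        minStretch (fderiv ℝ f (γ.natural s)) ≤ deriv (γ.lengthTransfer f) s ∧
          deriv (γ.lengthTransfer f) s ≤ ‖fderiv ℝ f (γ.natural s)‖) := by
  rw [ae_restrict_iff' (measurableSet_lengthInterval hγ)]
  exact PQDistortion.ae_minStretch_le_deriv_le_norm (ordConnected_lengthInterval hγ)
    (ordConnected_lengthInterval hβ) (hasUnitSpeedOn_natural hγ) (hasUnitSpeedOn_natural hβ)
    (h.monotoneOn_lengthTransfer hγ hβ)
    (mapsTo_iff_image_subset.2 (h.lengthTransfer_image hγ hβ).subset)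
    (h.natural_lengthTransfer hγ hβ)

theorem volume_not_differentiableAt_lengthTransfer (h : IsLifting f D γ β)
    (hγ : γ.LocallyRectifiable) (hβ : β.LocallyRectifiable) :
    volume (γ.lengthInterval \ {s | DifferentiableAt ℝ (γ.lengthTransfer f) s}) = 0 := by
  have hae := (h.ae_minStretch_le_deriv_le_norm hγ hβ).mono fun _ hs => hs.1
  rwa [ae_iff, Measure.restrict_apply' (measurableSet_lengthInterval hγ), inter_comm] at hae

/-- Change of variables along the monotone function `L_{γ,f}`, on the image of its points of
differentiability. -/
theorem lintegral_image_lengthTransfer (h : IsLifting f D γ β) (hγ : γ.LocallyRectifiable)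
    (hβ : β.LocallyRectifiable) (ρ : E n → ℝ≥0∞) :
    ∫⁻ t in γ.lengthTransfer f ''
        (γ.lengthInterval ∩ {s | DifferentiableAt ℝ (γ.lengthTransfer f) s}), ρ (β.natural t) =
      ∫⁻ s in γ.lengthInterval,
        ENNReal.ofReal (deriv (γ.lengthTransfer f) s) * ρ (f (γ.natural s)) := by
  have hm := measurableSet_lengthInterval hγ
  have hd := measurableSet_of_differentiableAt ℝ (γ.lengthTransfer f)
  rw [lintegral_image_eq_lintegral_deriv_mul_of_monotoneOn (hm.inter hd)
    (fun s hs => hs.2.hasDerivAt.hasDerivWithinAt)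
    ((h.monotoneOn_lengthTransfer hγ hβ).mono inter_subset_left)]
  rw [setLIntegral_congr_fun (hm.inter hd) fun s hs => by
    rw [show β.natural (γ.lengthTransfer f s) = f (γ.natural s) from
      h.natural_lengthTransfer hγ hβ hs.1]]
  refine setLIntegral_congr (ae_eq_set.2 ⟨?_, ?_⟩)
  · rw [sdiff_eq_empty.2 inter_subset_left, measure_empty]
  · rw [sdiff_self_inter]
    exact h.volume_not_differentiableAt_lengthTransfer hγ hβ

/-- The integral over the lifted curve with the weight `L'` is at most the integral over the image
curve; it may be smaller, as `L` need not have the `N`-property. -/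
theorem lintegral_deriv_mul_le_lineIntegral (h : IsLifting f D γ β) (hγ : γ.LocallyRectifiable)
    (hβ : β.LocallyRectifiable) (ρ : E n → ℝ≥0∞) :
    ∫⁻ s in γ.lengthInterval,
      ENNReal.ofReal (deriv (γ.lengthTransfer f) s) * ρ (f (γ.natural s)) ≤ β.lineIntegral ρ := by
  rw [← h.lintegral_image_lengthTransfer hγ hβ ρ]
  refine lintegral_mono_set ?_
  rw [← h.lengthTransfer_image hγ hβ]
  exact image_mono inter_subset_left

/-- When the length transfer function has the `N`-property, nothing is lost at the points where it
is not differentiable, and the change of variables is exact. -/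
theorem lineIntegral_eq_lintegral_deriv_mul (h : IsLifting f D γ β) (hγ : γ.LocallyRectifiable)
    (hβ : β.LocallyRectifiable) (hN : PropertyN (γ.lengthTransfer f) γ.lengthInterval)
    (ρ : E n → ℝ≥0∞) :
    β.lineIntegral ρ = ∫⁻ s in γ.lengthInterval,
      ENNReal.ofReal (deriv (γ.lengthTransfer f) s) * ρ (f (γ.natural s)) := by
  rw [← h.lintegral_image_lengthTransfer hγ hβ ρ, lineIntegral, ← h.lengthTransfer_image hγ hβ]
  refine setLIntegral_congr ?_
  nth_rewrite 1 [← inter_union_sdiff γ.lengthInterval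
    {s | DifferentiableAt ℝ (γ.lengthTransfer f) s}, image_union]
  exact union_ae_eq_left_of_ae_eq_empty (ae_eq_empty.2
    (hN _ sdiff_subset (h.volume_not_differentiableAt_lengthTransfer hγ hβ)))

end IsLifting

/-- The curve `f ∘ γ`. -/
def map (γ : Curve n) (f : E n → E n) (D : Set (E n)) (hf : ContinuousOn f D) (hγ : γ.locus ⊆ D) :
    Curve n where
  dom := γ.dom
  ordConnected := γ.ordConnected
  nonempty := γ.nonempty
  toFun := f ∘ γ.toFun
  continuousOn := hf.comp γ.continuousOn (mapsTo_iff_image_subset.2 hγ)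

theorem isLifting_map (γ : Curve n) (f : E n → E n) (D : Set (E n)) (hf : ContinuousOn f D)
    (hγ : γ.locus ⊆ D) : IsLifting f D γ (γ.map f D hf hγ) :=
  ⟨hγ, rfl, fun _ _ => rfl⟩

end Curve

/-! ### The modulus and exceptional families -/

/-- Families of modulus zero may be ignored when testing admissibility: the maximum of `ρ` with a
density of small integral that is admissible for the exceptional family is admissible. -/
theorem modulus_le_of_exceptional {p : ℝ} {Γ Γ₀ : Set (Curve n)}
    (h0 : modulus p Γ₀ = 0) {ρ : E n → ℝ≥0∞} (hρ : Measurable ρ)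
    (h : ∀ γ ∈ Γ, γ ∉ Γ₀ → γ.LocallyRectifiable → 1 ≤ γ.lineIntegral ρ) :
    modulus p Γ ≤ ∫⁻ x, ρ x ^ p := by
  refine ENNReal.le_of_forall_pos_le_add fun ε hε _ => ?_
  have hlt : modulus p Γ₀ < ε := by rw [h0]; exact_mod_cast hε
  simp only [modulus, iInf_lt_iff] at hlt
  obtain ⟨σ, ⟨hσm, hσ⟩, hσε⟩ := hlt
  have hadm : Admissible Γ fun x => max (ρ x) (σ x) := by
    refine ⟨hρ.max hσm, fun γ hγ hr => ?_⟩
    by_cases hγ0 : γ ∈ Γ₀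
    · exact (hσ γ hγ0 hr).trans (lintegral_mono fun _ => le_max_right _ _)
    · exact (h γ hγ hγ0 hr).trans (lintegral_mono fun _ => le_max_left _ _)
  calc modulus p Γ ≤ ∫⁻ x, max (ρ x) (σ x) ^ p := iInf₂_le _ hadm
    _ ≤ ∫⁻ x, (ρ x ^ p + σ x ^ p) := lintegral_mono fun x => by
        dsimp only
        rcases max_cases (ρ x) (σ x) with h | h <;> rw [h.1]
        · exact le_self_add
        · exact le_add_self
    _ = (∫⁻ x, ρ x ^ p) + ∫⁻ x, σ x ^ p := lintegral_add_left (hρ.pow_const p) _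
    _ ≤ (∫⁻ x, ρ x ^ p) + ε := by gcongr

/-! ### The regular set of a mapping -/

variable {f : E n → E n} {D : Set (E n)}

/-- The set of points of `D` where `f` is differentiable with a nonzero Jacobian. -/
def regularSet (f : E n → E n) (D : Set (E n)) : Set (E n) :=
  {x ∈ D | DifferentiableAt ℝ f x ∧ (fderiv ℝ f x).det ≠ 0}

theorem regularSet_subset : regularSet f D ⊆ D := fun _ hx => hx.1

theorem measurable_det_fderiv : Measurable fun x => (fderiv ℝ f x).det :=
  ContinuousLinearMap.continuous_det.measurable.comp (measurable_fderiv ℝ f)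

theorem measurableSet_regularSet (hD : MeasurableSet D) : MeasurableSet (regularSet f D) :=
  hD.inter ((measurableSet_of_differentiableAt ℝ f).inter
    (measurable_det_fderiv (measurableSet_singleton 0).compl))

/-- By Sard's theorem the critical values form a null set, and hence so do the critical points, by
the `N⁻¹`-property. -/
theorem RegularMapping.volume_sdiff_regularSet (hR : RegularMapping f D) (hD : MeasurableSet D) :
    volume (D \ regularSet f D) = 0 := by
  have h1 : volume (D \ {x | DifferentiableAt ℝ f x}) = 0 := by
    have := hR.differentiable_ae
    rwa [ae_iff, Measure.restrict_apply' hD, inter_comm] at this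
  let Z : Set (E n) := {x ∈ D | DifferentiableAt ℝ f x ∧ (fderiv ℝ f x).det = 0}
  have h2 : volume (f '' Z) = 0 := addHaar_image_eq_zero_of_det_fderivWithin_eq_zero volume
    (fun x hx => hx.2.1.hasFDerivAt.hasFDerivWithinAt) fun x hx => hx.2.2
  have h3 := hR.propertyNInv _ h2
  refine measure_mono_null (fun x hx => ?_) (measure_union_null h1 h3)
  by_cases hd : DifferentiableAt ℝ f x
  · exact Or.inr ⟨hx.1, mem_image_of_mem f ⟨hx.1, hd, by
      by_contra hc
      exact hx.2 ⟨hx.1, hd, hc⟩⟩⟩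
  · exact Or.inl ⟨hx.1, hd⟩

/-- The regular set is a countable disjoint union of Borel sets on which `f` is injective, namely
sets on which `f` is close, in the Lipschitz sense, to an invertible linear map. -/
theorem exists_partition_injOn_regularSet (f : E n → E n) (hD : MeasurableSet D) :
    ∃ C : ℕ → Set (E n), Pairwise (Function.onFun Disjoint C) ∧ (∀ k, MeasurableSet (C k)) ∧
      ⋃ k, C k = regularSet f D ∧ ∀ k, InjOn f (C k) := by
  have hr : ∀ A : E n →L[ℝ] E n, ∃ r : NNReal, r ≠ 0 ∧ (A.det ≠ 0 → ∀ S : Set (E n),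
      ApproximatesLinearOn f A S r → InjOn f S) := by
    intro A
    by_cases hA : A.det = 0
    · exact ⟨1, one_ne_zero, fun h => absurd hA h⟩
    · let B : E n ≃L[ℝ] E n := A.toContinuousLinearEquivOfDetNeZero hA
      have hB : (B : E n →L[ℝ] E n) = A := A.coe_toContinuousLinearEquivOfDetNeZero hA
      rcases B.subsingleton_or_nnnorm_symm_pos with hs | hs
      · exact ⟨1, one_ne_zero, fun _ S _ x _ y _ _ => Subsingleton.elim x y⟩
      · refine ⟨‖(B.symm : E n →L[ℝ] E n)‖₊⁻¹ / 2, (half_pos (inv_pos.2 hs)).ne',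
          fun _ S hS => ?_⟩
        rw [← hB] at hS
        exact hS.injOn (Or.inr (half_lt_self (inv_pos.2 hs)))
  choose r hr0 hrinj using hr
  obtain ⟨t, A, htd, htm, hcov, happ, hA⟩ :=
    exists_partition_approximatesLinearOn_of_hasFDerivWithinAt f (regularSet f D) (fderiv ℝ f)
      (fun x hx => hx.2.1.hasFDerivAt.hasFDerivWithinAt) r hr0
  refine ⟨fun k => regularSet f D ∩ t k, fun i j hij =>
    (htd hij).mono inter_subset_right inter_subset_right,
    fun k => (measurableSet_regularSet hD).inter (htm k), ?_, fun k => ?_⟩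
  · rw [← inter_iUnion, inter_eq_left.2 hcov]
  · rcases (regularSet f D).eq_empty_or_nonempty with he | hne
    · simp [he]
    · obtain ⟨y, hy, hyA⟩ := hA hne k
      exact hrinj _ (hyA ▸ hy.2.2) _ (happ k)

/-! ### Push-forward of densities -/

/-- The supremum of `g` over the points of `C` that `f` maps to `y`. -/
noncomputable def fiberSup (f : E n → E n) (C : Set (E n)) (g : E n → ℝ≥0∞) (y : E n) : ℝ≥0∞ :=
  ⨆ x ∈ C ∩ f ⁻¹' {y}, g x

theorem le_fiberSup {C : Set (E n)} (g : E n → ℝ≥0∞) {x : E n} (hx : x ∈ C) :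
    g x ≤ fiberSup f C g (f x) :=
  le_iSup₂ (f := fun x' (_ : x' ∈ C ∩ f ⁻¹' {f x}) => g x') x ⟨hx, rfl⟩

theorem fiberSup_apply_of_injOn {C : Set (E n)} (g : E n → ℝ≥0∞) (hC : InjOn f C) {x : E n}
    (hx : x ∈ C) : fiberSup f C g (f x) = g x := by
  refine le_antisymm (iSup₂_le fun z hz => ?_) (le_fiberSup g hx)
  rw [hC hz.1 hx hz.2]

theorem fiberSup_rpow {C : Set (E n)} (g : E n → ℝ≥0∞) {q : ℝ} (hq : 0 < q) (y : E n) :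
    fiberSup f C g y ^ q = fiberSup f C (fun x => g x ^ q) y := by
  have := (ENNReal.orderIsoRpow q hq).map_iSup₂ fun x (_ : x ∈ C ∩ f ⁻¹' {y}) => g x
  simp only [ENNReal.orderIsoRpow_apply] at this
  exact this

/-- The superlevel sets of `fiberSup` are countable unions of injective continuous images of Borel
sets, which are Borel by the Lusin–Souslin theorem. -/
theorem measurable_fiberSup {C : Set (E n)} {C' : ℕ → Set (E n)} (hC' : ∀ k, MeasurableSet (C' k))
    (hU : ⋃ k, C' k = C) (hinj : ∀ k, InjOn f (C' k)) (hf : ContinuousOn f C) {g : E n → ℝ≥0∞}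
    (hg : Measurable g) : Measurable (fiberSup f C g) := by
  refine measurable_of_Ioi fun a => ?_
  have heq : fiberSup f C g ⁻¹' Ioi a = ⋃ k, f '' (C' k ∩ g ⁻¹' Ioi a) := by
    rw [← image_iUnion, ← iUnion_inter, hU]
    ext y
    simp only [fiberSup, mem_preimage, mem_Ioi, lt_iSup_iff, mem_image, mem_inter_iff,
      mem_singleton_iff, exists_prop]
    exact ⟨fun ⟨x, hx, hax⟩ => ⟨x, ⟨hx.1, hax⟩, hx.2⟩, fun ⟨x, hx, hxy⟩ => ⟨x, ⟨hx.1, hxy⟩, hx.2⟩⟩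
  rw [heq]
  refine MeasurableSet.iUnion fun k => ?_
  refine ((hC' k).inter (hg measurableSet_Ioi)).image_of_continuousOn_injOn (hf.mono ?_)
    ((hinj k).mono inter_subset_left)
  exact inter_subset_left.trans (hU ▸ subset_iUnion C' k)

theorem lintegral_image_regularSet {C : Set (E n)} (hC : MeasurableSet C) (hCr : C ⊆ regularSet f D)
    (hinj : InjOn f C) (u : E n → ℝ≥0∞) :
    ∫⁻ y in f '' C, u y = ∫⁻ x in C, ENNReal.ofReal |(fderiv ℝ f x).det| * u (f x) :=
  lintegral_image_eq_lintegral_abs_det_fderiv_mul volume hC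
    (fun _ hx => (hCr hx).2.1.hasFDerivAt.hasFDerivWithinAt) hinj u

/-- The supremum over a fiber is at most the sum over the pieces of the regular set, and on each
piece the change of variables formula for injective maps applies. -/
theorem lintegral_fiberSup_le (hD : MeasurableSet D) (hf : ContinuousOn f D) {g : E n → ℝ≥0∞}
    (hg : Measurable g) :
    ∫⁻ y, fiberSup f (regularSet f D) g y ≤
      ∫⁻ x in regularSet f D, ENNReal.ofReal |(fderiv ℝ f x).det| * g x := by
  obtain ⟨C, hCd, hCm, hCU, hCi⟩ := exists_partition_injOn_regularSet f hD
  have hsub : ∀ k, C k ⊆ regularSet f D := fun k => hCU ▸ subset_iUnion C k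
  have hle : ∀ y, fiberSup f (regularSet f D) g y ≤ ∑' k, fiberSup f (C k) g y := fun y => by
    refine iSup₂_le fun x hx => ?_
    obtain ⟨hxr, rfl⟩ := hx
    rw [← hCU, mem_iUnion] at hxr
    obtain ⟨k, hk⟩ := hxr
    exact (le_fiberSup g hk).trans (ENNReal.le_tsum k)
  calc ∫⁻ y, fiberSup f (regularSet f D) g y ≤ ∫⁻ y, ∑' k, fiberSup f (C k) g y :=
        lintegral_mono hle
    _ = ∑' k, ∫⁻ y, fiberSup f (C k) g y := lintegral_tsum fun k =>
        (measurable_fiberSup (C' := fun _ => C k) (fun _ => hCm k) (iUnion_const _) (fun _ => hCi k)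
          (hf.mono ((hsub k).trans regularSet_subset)) hg).aemeasurable
    _ = ∑' k, ∫⁻ x in C k, ENNReal.ofReal |(fderiv ℝ f x).det| * g x := by
        congr 1
        ext k
        have hsupp : Function.support (fiberSup f (C k) g) ⊆ f '' C k := fun y hy => by
          by_contra hc
          refine hy ?_
          have : C k ∩ f ⁻¹' {y} = ∅ := by
            rw [eq_empty_iff_forall_notMem]
            exact fun x hx => hc ⟨x, hx.1, hx.2⟩
          simp [fiberSup, this]
        rw [← setLIntegral_eq_of_support_subset hsupp,
          lintegral_image_regularSet (hCm k) (hsub k) (hCi k)]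
        refine setLIntegral_congr_fun (hCm k) fun x hx => ?_
        rw [fiberSup_apply_of_injOn g (hCi k) hx]
    _ = ∫⁻ x in regularSet f D, ENNReal.ofReal |(fderiv ℝ f x).det| * g x := by
        rw [← lintegral_iUnion hCm hCd, hCU]

/-- Superadditivity of the lower integral; unlike the equality it needs no measurability. -/
theorem tsum_lintegral_le_lintegral_tsum {X : Type*} [MeasurableSpace X] (μ : Measure X)
    (G : ℕ → X → ℝ≥0∞) : ∑' k, ∫⁻ y, G k y ∂μ ≤ ∫⁻ y, ∑' k, G k y ∂μ := by
  rw [ENNReal.tsum_eq_iSup_sum]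
  refine iSup_le fun S => ?_
  refine le_trans ?_ (lintegral_mono fun y => ENNReal.sum_le_tsum S)
  induction S using Finset.cons_induction with
  | empty => simp
  | cons k S hk ih =>
    simp only [Finset.sum_cons]
    exact (add_le_add le_rfl ih).trans (le_lintegral_add _ _)

/-- The area formula, as an inequality with the multiplicity restricted to a set `A` that need not
be measurable. -/
theorem lintegral_regularSet_le_lintegral_tsum_fiber (hD : MeasurableSet D) {A C : Set (E n)}
    (hC : MeasurableSet C) (hCA : C ⊆ A) (hCr : C ⊆ regularSet f D) (g u : E n → ℝ≥0∞) :
    ∫⁻ x in C, ENNReal.ofReal |(fderiv ℝ f x).det| * (g x * u (f x)) ≤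
      ∫⁻ y in f '' A, (∑' x : ↥(A ∩ f ⁻¹' {y}), g x) * u y := by
  obtain ⟨C', hCd, hCm, hCU, hCi⟩ := exists_partition_injOn_regularSet f hD
  let G : ℕ → E n → ℝ≥0∞ := fun k y => ∑' x : ↥(A ∩ f ⁻¹' {y}), (C' k).indicator g x
  have hGg : ∀ k, ∀ x ∈ C ∩ C' k, g x ≤ G k (f x) := fun k x hx => by
    have := ENNReal.le_tsum (f := fun z : ↥(A ∩ f ⁻¹' {f x}) => (C' k).indicator g z)
      ⟨x, hCA hx.1, rfl⟩
    simpa [indicator_of_mem hx.2] using this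
  have hG : ∀ y, ∑' k, G k y ≤ ∑' x : ↥(A ∩ f ⁻¹' {y}), g x := fun y => by
    rw [ENNReal.tsum_comm]
    refine ENNReal.tsum_le_tsum fun x => ?_
    by_cases hx : ∃ k, (x : E n) ∈ C' k
    · obtain ⟨k, hk⟩ := hx
      rw [tsum_eq_single k fun j hj =>
        indicator_of_notMem (fun hxj => (hCd hj).le_bot ⟨hxj, hk⟩) g, indicator_of_mem hk]
    · push Not at hx
      simp [hx]
  have hCU' : ⋃ k, C ∩ C' k = C := by rw [← inter_iUnion, hCU, inter_eq_left.2 hCr]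
  have hm : ∀ k, MeasurableSet (C ∩ C' k) := fun k => hC.inter (hCm k)
  calc ∫⁻ x in C, ENNReal.ofReal |(fderiv ℝ f x).det| * (g x * u (f x))
      = ∑' k, ∫⁻ x in C ∩ C' k, ENNReal.ofReal |(fderiv ℝ f x).det| * (g x * u (f x)) := by
        rw [← lintegral_iUnion hm fun i j hij =>
          (hCd hij).mono inter_subset_right inter_subset_right, hCU']
    _ ≤ ∑' k, ∫⁻ x in C ∩ C' k, ENNReal.ofReal |(fderiv ℝ f x).det| * (G k (f x) * u (f x)) :=
        ENNReal.tsum_le_tsum fun k => setLIntegral_mono' (hm k) fun x hx => by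
          gcongr
          exact hGg k x hx
    _ = ∑' k, ∫⁻ y in f '' (C ∩ C' k), G k y * u y := by
        congr 1
        ext k
        rw [lintegral_image_regularSet (hm k) (inter_subset_left.trans hCr)
          ((hCi k).mono inter_subset_right) fun y => G k y * u y]
    _ ≤ ∑' k, ∫⁻ y in f '' A, G k y * u y := ENNReal.tsum_le_tsum fun k =>
        lintegral_mono_set (image_mono (inter_subset_left.trans hCA))
    _ ≤ ∫⁻ y in f '' A, ∑' k, G k y * u y := tsum_lintegral_le_lintegral_tsum _ _
    _ ≤ ∫⁻ y in f '' A, (∑' x : ↥(A ∩ f ⁻¹' {y}), g x) * u y := lintegral_mono fun y => by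
        dsimp only
        rw [ENNReal.tsum_mul_right]
        gcongr
        exact hG y

/-! ### The two modulus inequalities -/

theorem lintegral_add_indicator_top_rpow {X : Type*} [MeasurableSpace X] {μ : Measure X} {N : Set X}
    (hN : μ N = 0) (F : X → ℝ≥0∞) (p : ℝ) :
    ∫⁻ x, (F x + N.indicator (fun _ => ∞) x) ^ p ∂μ = ∫⁻ x, F x ^ p ∂μ := by
  refine lintegral_congr_ae ?_
  filter_upwards [measure_eq_zero_iff_ae_notMem.1 hN] with x hx
  rw [indicator_of_notMem hx, add_zero]

theorem abs_det_mul_div_minStretch_rpow {q : ℝ} (hn : 0 < n) (hq : 0 ≤ q) {x : E n}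
    (hx : (fderiv ℝ f x).det ≠ 0) (r : ℝ≥0∞) :
    ENNReal.ofReal |(fderiv ℝ f x).det| * (r / ENNReal.ofReal (minStretch (fderiv ℝ f x))) ^ q =
      innerDilatation q f x * r ^ q := by
  have hl := minStretch_pos hn hx
  rw [innerDilatation, if_pos hx, ENNReal.div_rpow_of_nonneg _ _ hq,
    ENNReal.ofReal_rpow_of_pos hl, ENNReal.ofReal_div_of_pos (Real.rpow_pos_of_pos hl q),
    div_eq_mul_inv, div_eq_mul_inv, mul_assoc, mul_comm (r ^ q)]

theorem norm_fderiv_rpow_eq {p : ℝ} (hp : 0 ≤ p) {x : E n} (hx : (fderiv ℝ f x).det ≠ 0) :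
    ENNReal.ofReal ‖fderiv ℝ f x‖ ^ p =
      ENNReal.ofReal |(fderiv ℝ f x).det| * outerDilatation p f x := by
  rw [outerDilatation, if_pos hx, ENNReal.ofReal_rpow_of_nonneg (norm_nonneg _) hp,
    ← ENNReal.ofReal_mul (abs_nonneg _), mul_div_cancel₀ _ (abs_ne_zero.2 hx)]

/-- The density `ρ / l(f')` on the regular set, pushed forward by taking the supremum over the fibers
of `f` and made infinite on a null set containing the image of the exceptional points, is admissible
for `f(Γ)` up to the exceptional family of the property `L⁽²⁾_q`. -/
theorem RegularMapping.poletskiiInequality (hn : 0 < n) {q : ℝ} (hq : 0 < q) (hD : MeasurableSet D)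
    (hf : ContinuousOn f D) (hR : RegularMapping f D) (hL : PropertyL2 q f D) :
    PoletskiiInequality q f D := by
  intro Γ _ ρ ⟨hρm, hρ⟩
  obtain ⟨N, hNsub, hNm, hN0⟩ := exists_measurable_superset_of_null
    (hR.propertyN _ sdiff_subset (hR.volume_sdiff_regularSet hD))
  let g : E n → ℝ≥0∞ := fun x => ρ x / ENNReal.ofReal (minStretch (fderiv ℝ f x))
  have hgm : Measurable g := hρm.div
    (continuous_minStretch.measurable.comp (measurable_fderiv ℝ f)).ennreal_ofReal
  obtain ⟨C, -, hCm, hCU, hCi⟩ := exists_partition_injOn_regularSet f hD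
  have hFm : Measurable (fiberSup f (regularSet f D) g) :=
    measurable_fiberSup hCm hCU hCi (hf.mono regularSet_subset) hgm
  let σ : E n → ℝ≥0∞ := fun y =>
    fiberSup f (regularSet f D) g y + N.indicator (fun _ => ∞) y
  have hσm : Measurable σ := hFm.add (measurable_const.indicator hNm)
  have hmod : modulus q (imageFamily f D Γ) ≤ ∫⁻ y, σ y ^ q := by
    refine modulus_le_of_exceptional hL hσm fun β hβΓ hβ0 hβ => ?_
    obtain ⟨γ, hγΓ, hlift⟩ := hβΓ
    have hlocus : β.locus ⊆ f '' D := by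
      rintro _ ⟨t, ht, rfl⟩
      rw [hlift.2.1] at ht
      exact ⟨γ.toFun t, hlift.1 (mem_image_of_mem _ ht), (hlift.2.2 ht).symm⟩
    obtain ⟨hγ, hNinv⟩ := (not_not.1 fun hc => hβ0 ⟨hlocus, hc⟩ :
      ∀ γ : Curve n, Curve.IsLifting f D γ β →
        γ.LocallyRectifiable ∧ PropertyNInv (γ.lengthTransfer f) γ.lengthInterval) γ hlift
    by_cases htop : β.lineIntegral σ = ∞
    · rw [htop]
      exact le_top
    have havoid := Curve.ae_natural_notMem_of_lineIntegral_ne_top hβ hσm (N := N)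
      (fun y hy => by simp [σ, hy]) htop
    -- The `N⁻¹`-property turns "`β` spends no length in `N`" into "`γ` spends no length outside
    -- the regular set".
    have hreg : ∀ᵐ s ∂volume.restrict γ.lengthInterval, γ.natural s ∈ regularSet f D := by
      rw [ae_iff, Measure.restrict_apply' (Curve.measurableSet_lengthInterval hβ)] at havoid
      have h0 := hNinv _ havoid
      rw [ae_iff, Measure.restrict_apply' (Curve.measurableSet_lengthInterval hγ)]
      refine measure_mono_null ?_ h0
      intro s hs
      refine ⟨hs.2, ?_, ?_⟩
      · have hfs : f (γ.natural s) ∈ N :=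
          hNsub ⟨_, ⟨hlift.1 (Curve.natural_mem_locus hγ hs.2), hs.1⟩, rfl⟩
        rw [mem_ofPred_eq, not_not]
        rwa [← Function.comp_apply (f := f), ← hlift.natural_lengthTransfer hγ hβ hs.2] at hfs
      · rw [← hlift.lengthTransfer_image hγ hβ]
        exact mem_image_of_mem _ hs.2
    calc 1 ≤ γ.lineIntegral ρ := hρ γ hγΓ hγ
      _ ≤ ∫⁻ s in γ.lengthInterval,
          ENNReal.ofReal (deriv (γ.lengthTransfer f) s) * σ (f (γ.natural s)) := by
        refine lintegral_mono_ae ?_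
        filter_upwards [hreg, hlift.ae_minStretch_le_deriv_le_norm hγ hβ] with s hs hds
        have hl := minStretch_pos hn hs.2.2
        calc ρ (γ.natural s)
            = ENNReal.ofReal (minStretch (fderiv ℝ f (γ.natural s))) * g (γ.natural s) :=
              (ENNReal.mul_div_cancel (ENNReal.ofReal_pos.2 hl).ne' ENNReal.ofReal_ne_top).symm
          _ ≤ _ := by
            gcongr
            · exact (hds.2 hs.2.1).1
            · exact (le_fiberSup g hs).trans le_self_add
      _ ≤ β.lineIntegral σ := hlift.lintegral_deriv_mul_le_lineIntegral hγ hβ σ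
  calc modulus q (imageFamily f D Γ) ≤ ∫⁻ y, σ y ^ q := hmod
    _ = ∫⁻ y, fiberSup f (regularSet f D) (fun x => g x ^ q) y := by
      simp only [σ, lintegral_add_indicator_top_rpow hN0, fiberSup_rpow _ hq]
    _ ≤ ∫⁻ x in regularSet f D, ENNReal.ofReal |(fderiv ℝ f x).det| * g x ^ q :=
      lintegral_fiberSup_le hD hf (hgm.pow_const q)
    _ = ∫⁻ x in regularSet f D, innerDilatation q f x * ρ x ^ q :=
      setLIntegral_congr_fun (measurableSet_regularSet hD) fun x hx =>
        abs_det_mul_div_minStretch_rpow hn hq.le hx.2.2 _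
    _ ≤ ∫⁻ x in D, innerDilatation q f x * ρ x ^ q := lintegral_mono_set regularSet_subset

/-- The density `‖f'‖ ρ ∘ f` on the regular points of `A`, made infinite on a null set containing
the other points of `A`, is admissible for `Γ` up to the exceptional family of the property
`L⁽¹⁾_p`. -/
theorem RegularMapping.inverseInequality {p : ℝ} (hp : 0 < p) (hD : MeasurableSet D)
    (hf : ContinuousOn f D) (hR : RegularMapping f D) (hL : PropertyL1 p f D) :
    InverseInequality p f D := by
  classical
  intro A hAD hA Γ hΓ ρ ⟨hρm, hρ⟩
  obtain ⟨A₁, hA₁A, hA₁m, hA₁⟩ := hA.exists_measurable_subset_ae_eq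
  let C : Set (E n) := A₁ ∩ regularSet f D
  have hCm : MeasurableSet C := hA₁m.inter (measurableSet_regularSet hD)
  have hnull : volume (A \ C) = 0 := by
    refine measure_mono_null (fun x hx => ?_)
      (measure_union_null (ae_eq_set.1 hA₁).2 (hR.volume_sdiff_regularSet hD))
    by_cases hx₁ : x ∈ A₁
    · exact Or.inr ⟨hAD hx.1, fun hc => hx.2 ⟨hx₁, hc⟩⟩
    · exact Or.inl ⟨hx.1, hx₁⟩
  obtain ⟨N, hNsub, hNm, hN0⟩ := exists_measurable_superset_of_null hnull
  let F : E n → ℝ≥0∞ := C.indicator fun x => ENNReal.ofReal ‖fderiv ℝ f x‖ * ρ (f x)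
  have hFm : Measurable F := by
    have hpw : Measurable (C.piecewise f fun _ => 0) := ContinuousOn.measurable_piecewise
      (hf.mono (inter_subset_right.trans regularSet_subset)) continuousOn_const hCm
    have hF : F = C.indicator fun x =>
        ENNReal.ofReal ‖fderiv ℝ f x‖ * ρ (C.piecewise f (fun _ => 0) x) :=
      indicator_congr fun x hx => by rw [piecewise_eq_of_mem _ _ _ hx]
    rw [hF]
    exact ((measurable_fderiv ℝ f).norm.ennreal_ofReal.mul (hρm.comp hpw)).indicator hCm
  let σ : E n → ℝ≥0∞ := fun x => F x + N.indicator (fun _ => ∞) x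
  have hσm : Measurable σ := hFm.add (measurable_const.indicator hNm)
  have hmod : modulus p Γ ≤ ∫⁻ x, σ x ^ p := by
    refine modulus_le_of_exceptional hL hσm fun γ hγΓ hγ0 hγ => ?_
    have hγD := (hΓ γ hγΓ).trans hAD
    obtain ⟨hbv, hN⟩ := (not_not.1 fun hc => hγ0 ⟨hγD, hc⟩ :
      LocallyBoundedVariationOn (f ∘ γ.toFun) γ.dom ∧
        PropertyN (γ.lengthTransfer f) γ.lengthInterval)
    have hlift := γ.isLifting_map f D hf hγD
    have hβ := hlift.locallyRectifiable hbv
    by_cases htop : γ.lineIntegral σ = ∞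
    · rw [htop]
      exact le_top
    have havoid := Curve.ae_natural_notMem_of_lineIntegral_ne_top hγ hσm (N := N)
      (fun x hx => by simp [σ, hx]) htop
    calc 1 ≤ (γ.map f D hf hγD).lineIntegral ρ := hρ _ ⟨γ, hγΓ, hlift⟩ hβ
      _ = ∫⁻ s in γ.lengthInterval,
          ENNReal.ofReal (deriv (γ.lengthTransfer f) s) * ρ (f (γ.natural s)) :=
        hlift.lineIntegral_eq_lintegral_deriv_mul hγ hβ hN ρ
      _ ≤ γ.lineIntegral σ := by
        refine lintegral_mono_ae ?_
        filter_upwards [havoid, hlift.ae_minStretch_le_deriv_le_norm hγ hβ,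
          ae_restrict_mem (Curve.measurableSet_lengthInterval hγ)] with s hsN hds hs
        have hsC : γ.natural s ∈ C := by
          by_contra hc
          exact hsN (hNsub ⟨hΓ γ hγΓ (Curve.natural_mem_locus hγ hs), hc⟩)
        refine le_trans ?_ le_self_add
        simp only [F, indicator_of_mem hsC]
        gcongr
        exact (hds.2 hsC.2.2.1).2
  calc modulus p Γ ≤ ∫⁻ x, σ x ^ p := hmod
    _ = ∫⁻ x, F x ^ p := lintegral_add_indicator_top_rpow hN0 F p
    _ = ∫⁻ x in C, (ENNReal.ofReal ‖fderiv ℝ f x‖ * ρ (f x)) ^ p := by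
      rw [← lintegral_indicator hCm]
      refine lintegral_congr fun x => ?_
      by_cases hx : x ∈ C
      · simp only [F, indicator_of_mem hx]
      · simp only [F, indicator_of_notMem hx, ENNReal.zero_rpow_of_pos hp]
    _ = ∫⁻ x in C,
        ENNReal.ofReal |(fderiv ℝ f x).det| * (outerDilatation p f x * ρ (f x) ^ p) :=
      setLIntegral_congr_fun hCm fun x hx => by
        simp only [ENNReal.mul_rpow_of_nonneg _ _ hp.le, norm_fderiv_rpow_eq hp.le hx.2.2.2,
          mul_assoc]
    _ ≤ ∫⁻ y in f '' A, inverseDilatation p f A y * ρ y ^ p :=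
      lintegral_regularSet_le_lintegral_tsum_fiber hD hCm (inter_subset_left.trans hA₁A)
        inter_subset_right (outerDilatation p f) fun y => ρ y ^ p

end PQDistortion

theorem theorem1 {n : ℕ} (hn : 2 ≤ n) {p q : ℝ} (hp : 1 ≤ p) (hq : 1 ≤ q)
    {D : Set (PQDistortion.E n)} (hDopen : IsOpen D) (hDconn : IsConnected D)
    {f : PQDistortion.E n → PQDistortion.E n} (hf : ContinuousOn f D) :
    (PQDistortion.FiniteLengthDistortion p q f D →
      PQDistortion.PoletskiiInequality q f D ∧ PQDistortion.InverseInequality p f D) ∧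
    (PQDistortion.RegularMapping f D → PQDistortion.PropertyL2 q f D →
      PQDistortion.PoletskiiInequality q f D) ∧
    (PQDistortion.RegularMapping f D → PQDistortion.PropertyL1 p f D →
      PQDistortion.InverseInequality p f D) := by
  have h1 : PQDistortion.RegularMapping f D → PQDistortion.PropertyL2 q f D →
      PQDistortion.PoletskiiInequality q f D := fun hR hL =>
    hR.poletskiiInequality (by omega) (by linarith) hDopen.measurableSet hf hL
  have h2 : PQDistortion.RegularMapping f D → PQDistortion.PropertyL1 p f D →
      PQDistortion.InverseInequality p f D := fun hR hL =>
    hR.inverseInequality (by linarith) hDopen.measurableSet hf hL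
  exact ⟨fun h => ⟨h1 h.toRegularMapping h.propertyL2, h2 h.toRegularMapping h.propertyL1⟩, h1, h2⟩
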